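/- Let $m$ be a positive integer, $[m]=\{1,\dots,m\}$, and let $\{W(k)\}_{k\ge 0}$ be a random model on a probability space, i.e. a sequence of random $m\times m$ row-stochastic matrices with Borel measurable entries. For a sequence of $m\times m$ stochastic matrices, a starting time $t_0\ge 0$ and a starting point $x(t_0)\in\mathbb{R}^m$, consider the dynamics $x(k+1)=W(k)x(k)$ for $k\ge t_0$. A deterministic chain $\{A(k)\}$ of stochastic matrices is *ergodic* if, for the dynamics $x(k+1)=A(k)x(k)$, $\lim_{k\to\infty}(x_i(k)-x_j(k))=0$ for all $i,j\in[m]$, every $t_0\ge 0$ and every $x(t_0)\in\mathbb{R}^m$. It has the *infinite flow property* if $\sum_{k=0}^\infty\sum_{i\in S,\,j\notin S}(A_{ij}(k)+A_{ji}(k))=\infty$ for every nonempty proper subset $S$ of $[m]$. A random model is ergodic, respectively has the infinite flow property, if almost every realization of it does. The *expected model* is the deterministic chain $\{\mathbb{E}[W(k)]\}$. Assume: 1. (class $\mathscr{M}_2$) the matrices $W(0),W(1),\dots$ are mutually independent and, with $H(k)=\mathbb{E}[W(k)^TW(k)]$, for every $t_0\ge 0$ and every (deterministic) $x(t_0)\in\mathbb{R}^m$,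 $$\sum_{k=t_0}^\infty\sum_{i<j}H_{ij}(k)\,\mathbb{E}\big[(x_i(k)-x_j(k))^2\big]<\infty;$$ 2. (weak feedback property) there is $\gamma>0$ such that $\mathbb{E}[W^i(k)^TW^j(k)]\ge\gamma\,(\mathbb{E}[W_{ij}(k)]+\mathbb{E}[W_{ji}(k)])$ for all $k\ge 0$ and all $i\ne j$ in $[m]$, where $W^i(k)$ is the $i$-th column of $W(k)$. Then the following are equivalent: (a) the model $\{W(k)\}$ is ergodic; (b) the model $\{W(k)\}$ has the infinite flow property; (c) the expected model $\{\mathbb{E}[W(k)]\}$ has the infinite flow property; (d) the expected model $\{\mathbb{E}[W(k)]\}$ is ergodic. -/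

import Mathlib

open MeasureTheory ProbabilityTheory Filter Topology
open scoped Matrix

namespace InfiniteFlow

/-- The state `x (t₀ + n)` of the linear system `x (k + 1) = A k x k` (`k ≥ t₀`) started at
time `t₀` from `x t₀ = v`. -/
def state {m : ℕ} (A : ℕ → Matrix (Fin m) (Fin m) ℝ) (t₀ : ℕ) (v : Fin m → ℝ) :
    ℕ → Fin m → ℝ
  | 0 => v
  | n + 1 => A (t₀ + n) *ᵥ state A t₀ v n

/-- A deterministic chain is ergodic if all differences `x i - x j` of coordinates tend to `0`,
for every starting time and every starting point. -/
def IsErgodic {m : ℕ} (A : ℕ → Matrix (Fin m) (Fin m) ℝ) : Prop :=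
  ∀ (t₀ : ℕ) (v : Fin m → ℝ) (i j : Fin m),
    Tendsto (fun n => state A t₀ v n i - state A t₀ v n j) atTop (𝓝 0)

/-- The flow `A_S = ∑ i ∈ S, ∑ j ∉ S, (A i j + A j i)`. -/
def flow {m : ℕ} (S : Finset (Fin m)) (A : Matrix (Fin m) (Fin m) ℝ) : ℝ :=
  ∑ i ∈ S, ∑ j ∈ Sᶜ, (A i j + A j i)

/-- A deterministic chain has the infinite flow property if `∑ k, A_S (k) = ∞` for every
nonempty proper subset `S` of the index set. -/
def HasInfiniteFlow {m : ℕ} (A : ℕ → Matrix (Fin m) (Fin m) ℝ) : Prop :=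
  ∀ S : Finset (Fin m), S.Nonempty → S ≠ Finset.univ →
    Tendsto (fun n => ∑ k ∈ Finset.range n, flow S (A k)) atTop atTop

/-- A random model: a sequence of random (row-)stochastic matrices with measurable entries. -/
structure IsRandomModel {Ω : Type*} [MeasurableSpace Ω] {m : ℕ}
    (W : ℕ → Ω → Matrix (Fin m) (Fin m) ℝ) : Prop where
  measurable_entry : ∀ k i j, Measurable fun ω => W k ω i j
  stochastic : ∀ k ω, W k ω ∈ Matrix.rowStochastic ℝ (Fin m)

/-- The model is independent: the random matrices `W 0, W 1, …` are mutually independent, where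
the space of matrices carries the product (Borel) σ-algebra. -/
def IsIndependentModel {Ω : Type*} [MeasurableSpace Ω] {m : ℕ} (μ : Measure Ω)
    (W : ℕ → Ω → Matrix (Fin m) (Fin m) ℝ) : Prop :=
  iIndepFun (β := fun _ : ℕ => Fin m → Fin m → ℝ) (fun k ω i j => W k ω i j) μ

/-- A random model is ergodic if almost every realization is an ergodic chain. -/
def IsErgodicModel {Ω : Type*} [MeasurableSpace Ω] {m : ℕ} (μ : Measure Ω)
    (W : ℕ → Ω → Matrix (Fin m) (Fin m) ℝ) : Prop :=
  ∀ᵐ ω ∂μ, IsErgodic fun k => W k ω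

/-- A random model has the infinite flow property if almost every realization has it. -/
def HasInfiniteFlowModel {Ω : Type*} [MeasurableSpace Ω] {m : ℕ} (μ : Measure Ω)
    (W : ℕ → Ω → Matrix (Fin m) (Fin m) ℝ) : Prop :=
  ∀ᵐ ω ∂μ, HasInfiniteFlow fun k => W k ω

/-- The entrywise expectation of a random matrix. -/
noncomputable def expectation {Ω : Type*} [MeasurableSpace Ω] {m : ℕ} (μ : Measure Ω)
    (M : Ω → Matrix (Fin m) (Fin m) ℝ) : Matrix (Fin m) (Fin m) ℝ :=
  Matrix.of fun i j => ∫ ω, M ω i j ∂μ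

/-- The expected model, a deterministic chain. -/
noncomputable def expectedModel {Ω : Type*} [MeasurableSpace Ω] {m : ℕ} (μ : Measure Ω)
    (W : ℕ → Ω → Matrix (Fin m) (Fin m) ℝ) : ℕ → Matrix (Fin m) (Fin m) ℝ :=
  fun k => expectation μ (W k)

/-- Weak feedback property; `(W k ω).col i` is the `i`-th column of `W k ω`. -/
def HasWeakFeedback {Ω : Type*} [MeasurableSpace Ω] {m : ℕ} (μ : Measure Ω)
    (W : ℕ → Ω → Matrix (Fin m) (Fin m) ℝ) : Prop :=
  ∃ γ : ℝ, 0 < γ ∧ ∀ (k : ℕ) (i j : Fin m), i ≠ j →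
    γ * ((∫ ω, W k ω i j ∂μ) + ∫ ω, W k ω j i ∂μ) ≤
      ∫ ω, (W k ω).col i ⬝ᵥ (W k ω).col j ∂μ

/-- The class `M₂`: independent models such that, for every starting time `t₀` and every
(deterministic) starting point `v`, the series
`∑ k ≥ t₀, ∑ i < j, H i j (k) * E[(x i (k) - x j (k)) ^ 2]` converges, where
`H (k) = E[W(k)ᵀ W(k)]`. For a random model the terms of this series are nonnegative. -/
def IsClassM2 {Ω : Type*} [MeasurableSpace Ω] {m : ℕ} (μ : Measure Ω)
    (W : ℕ → Ω → Matrix (Fin m) (Fin m) ℝ) : Prop :=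
  IsIndependentModel μ W ∧
    ∀ (t₀ : ℕ) (v : Fin m → ℝ),
      Summable fun n : ℕ => ∑ i : Fin m, ∑ j ∈ Finset.Ioi i,
        expectation μ (fun ω => (W (t₀ + n) ω)ᵀ * W (t₀ + n) ω) i j *
          ∫ ω, (state (fun k => W k ω) t₀ v n i - state (fun k => W k ω) t₀ v n j) ^ 2 ∂μ

end InfiniteFlow

/-! The heart is (c) → (a). Weak feedback bounds `γ (E[W_ij] + E[W_ji])` by `H_ij` for `i ≠ j`, so
the `M₂` condition makes the sum over `k` of `E[W_ij(k)] E[(x_i(k) - x_j(k))²]` finite. Since `x(k)`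
is independent of `W(k)`, this is also the expected energy weighted by the random entries. Hence
almost surely a trajectory has finite energy with respect to both `W` and the expected model
(`summable_expectedModel_mul`, `ae_summable_of_summable_integral`).

The rest is pathwise (`tendsto_state_sub_of_summable`). Without consensus, at some late time a set
`S` is separated from its complement by a gap, while little `W`-energy remains. Flow across a gap
costs energy, so too little flow is left to close it, and half of it survives forever
(`half_gap_le`). Finite energy for the expected model then makes its flow over `S` summable,
contradicting infinite flow.

(a) → (b) and (d) → (c) are one deterministic fact: with finite flow over `S`, a late start from the
indicator of the complement of `S` never mixes. (b) → (c) is Tonelli; (a) → (d) is independence with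
dominated convergence. -/

namespace InfiniteFlow

variable {m : ℕ}

/-! ### Flow as a bound on the drift of a trajectory. -/

lemma flow_nonneg {M : Matrix (Fin m) (Fin m) ℝ} (hM : ∀ i j, 0 ≤ M i j) (S : Finset (Fin m)) :
    0 ≤ flow S M :=
  Finset.sum_nonneg fun i _ => Finset.sum_nonneg fun j _ => add_nonneg (hM i j) (hM j i)

lemma flow_compl (S : Finset (Fin m)) (M : Matrix (Fin m) (Fin m) ℝ) :
    flow Sᶜ M = flow S M := by
  unfold flow
  rw [Finset.sum_comm, compl_compl]
  simp only [add_comm]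

lemma sum_compl_le_flow {M : Matrix (Fin m) (Fin m) ℝ} (hM : ∀ i j, 0 ≤ M i j)
    {S : Finset (Fin m)} {p : Fin m} (hp : p ∈ S) : ∑ q ∈ Sᶜ, M p q ≤ flow S M :=
  (Finset.sum_le_sum fun q _ => le_add_of_nonneg_right (hM q p)).trans
    (Finset.single_le_sum (f := fun i => ∑ j ∈ Sᶜ, (M i j + M j i))
      (fun i _ => Finset.sum_nonneg fun j _ => add_nonneg (hM i j) (hM j i)) hp)

/-- If `x ≤ u` on `S` and `x ≤ u + R` everywhere, then one step of a stochastic matrix raises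
the values on `S` above `u` by at most `R` times the flow over `S`. -/
lemma mulVec_le_add_flow {M : Matrix (Fin m) (Fin m) ℝ} (hM : M ∈ Matrix.rowStochastic ℝ (Fin m))
    {S : Finset (Fin m)} {x : Fin m → ℝ} {u R : ℝ} (hR : 0 ≤ R) (hS : ∀ q ∈ S, x q ≤ u)
    (hx : ∀ q, x q ≤ u + R) {p : Fin m} (hp : p ∈ S) : (M *ᵥ x) p ≤ u + R * flow S M := by
  have hsum := Matrix.sum_row_of_mem_rowStochastic hM p
  have h1 : (M *ᵥ x) p = u + ∑ q, M p q * (x q - u) := by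
    simp only [mul_sub, Finset.sum_sub_distrib, ← Finset.sum_mul, hsum, Matrix.mulVec, dotProduct]
    ring
  rw [h1, ← Finset.sum_add_sum_compl S]
  have h2 : ∑ q ∈ S, M p q * (x q - u) ≤ 0 := Finset.sum_nonpos fun q hq =>
    mul_nonpos_of_nonneg_of_nonpos (hM.1 p q) (sub_nonpos.2 (hS q hq))
  have h3 : ∑ q ∈ Sᶜ, M p q * (x q - u) ≤ R * ∑ q ∈ Sᶜ, M p q := by
    rw [Finset.mul_sum]
    refine Finset.sum_le_sum fun q _ => ?_
    rw [mul_comm R]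
    exact mul_le_mul_of_nonneg_left (by linarith [hx q]) (hM.1 p q)
  have h4 := mul_le_mul_of_nonneg_left (sum_compl_le_flow hM.1 hp) hR
  linarith

/-- Along a stochastic chain, the values on `S` rise at most by `R` times the accumulated flow. -/
lemma le_add_sum_flow {C : ℕ → Matrix (Fin m) (Fin m) ℝ}
    (hC : ∀ n, C n ∈ Matrix.rowStochastic ℝ (Fin m)) {x : ℕ → Fin m → ℝ}
    (hx : ∀ n, x (n + 1) = C n *ᵥ x n) {S : Finset (Fin m)} {u R : ℝ} (hR : 0 ≤ R)
    (h0 : ∀ p ∈ S, x 0 p ≤ u) (hb : ∀ n p, x n p ≤ u + R) (n : ℕ) :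
    ∀ p ∈ S, x n p ≤ u + R * ∑ k ∈ Finset.range n, flow S (C k) := by
  induction n with
  | zero => simpa using h0
  | succ n ih =>
    intro p hp
    have hT : 0 ≤ R * ∑ k ∈ Finset.range n, flow S (C k) :=
      mul_nonneg hR (Finset.sum_nonneg fun k _ => flow_nonneg (hC k).1 S)
    rw [hx, Finset.sum_range_succ, mul_add, ← add_assoc]
    exact mulVec_le_add_flow (hC n) hR ih (fun q => by linarith [hb n q]) hp

/-- The dual lower bound for `le_add_sum_flow`. -/
lemma sub_sum_flow_le {C : ℕ → Matrix (Fin m) (Fin m) ℝ}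
    (hC : ∀ n, C n ∈ Matrix.rowStochastic ℝ (Fin m)) {x : ℕ → Fin m → ℝ}
    (hx : ∀ n, x (n + 1) = C n *ᵥ x n) {S : Finset (Fin m)} {l R : ℝ} (hR : 0 ≤ R)
    (h0 : ∀ p ∉ S, l ≤ x 0 p) (hb : ∀ n p, l - R ≤ x n p) (n : ℕ) :
    ∀ p ∉ S, l - R * ∑ k ∈ Finset.range n, flow S (C k) ≤ x n p := by
  intro p hp
  -- Negation swaps upper and lower bounds, and the flow is the same for `S` and its complement.
  have h := le_add_sum_flow hC (x := fun n => -x n) (fun n => by rw [hx, Matrix.mulVec_neg])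
    (S := Sᶜ) (u := -l) hR (fun p hp => by simpa using h0 p (by simpa using hp))
    (fun n p => by simp only [Pi.neg_apply]; linarith [hb n p]) n p (by simpa using hp)
  simp only [Pi.neg_apply, flow_compl] at h
  linarith

lemma state_mem_Icc {A : ℕ → Matrix (Fin m) (Fin m) ℝ}
    (hA : ∀ n, A n ∈ Matrix.rowStochastic ℝ (Fin m)) {v : Fin m → ℝ} {a b : ℝ}
    (hv : ∀ i, v i ∈ Set.Icc a b) (t₀ n : ℕ) (i : Fin m) : state A t₀ v n i ∈ Set.Icc a b := by
  induction n generalizing i with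
  | zero => exact hv i
  | succ n ih =>
    have hsum := Matrix.sum_row_of_mem_rowStochastic (hA (t₀ + n)) i
    exact (convex_Icc a b).sum_mem (fun j _ => (hA (t₀ + n)).1 i j) hsum fun j _ => ih j

lemma abs_state_le {A : ℕ → Matrix (Fin m) (Fin m) ℝ}
    (hA : ∀ n, A n ∈ Matrix.rowStochastic ℝ (Fin m)) (t₀ : ℕ) (v : Fin m → ℝ) (n : ℕ)
    (i : Fin m) : |state A t₀ v n i| ≤ ∑ j, |v j| :=
  abs_le.2 (state_mem_Icc hA (fun i => abs_le.1 (Finset.single_le_sum (f := fun j => |v j|)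
    (fun j _ => abs_nonneg (v j)) (Finset.mem_univ i))) t₀ n i)

/-! ### Necessity of infinite flow. -/

/-- Infinite flow is necessary for ergodicity of a stochastic chain. -/
theorem IsErgodic.hasInfiniteFlow {A : ℕ → Matrix (Fin m) (Fin m) ℝ}
    (hA : ∀ n, A n ∈ Matrix.rowStochastic ℝ (Fin m)) (h : IsErgodic A) : HasInfiniteFlow A := by
  intro S hS hS'
  have hnn : ∀ k, 0 ≤ flow S (A k) := fun k => flow_nonneg (hA k).1 S
  rw [← not_summable_iff_tendsto_nat_atTop_of_nonneg hnn]
  intro hsum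
  -- With tail flow at most `1/4`, each side of a unit gap moves by at most `1/4`, leaving `1/2`.
  obtain ⟨N, hN⟩ := ((tendsto_sum_nat_add fun k => flow S (A k)).eventually_lt_const
    (show (0 : ℝ) < 1 / 4 by norm_num)).exists
  have hT : ∀ n, ∑ k ∈ Finset.range n, flow S (A (N + k)) ≤ 1 / 4 := by
    intro n
    simp only [add_comm N]
    exact (((summable_nat_add_iff N).2 hsum).sum_le_tsum _ fun k _ => hnn _).trans hN.le
  obtain ⟨p, hp⟩ := hS
  obtain ⟨q, hq⟩ : ∃ q, q ∉ S := by
    by_contra! hc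
    exact hS' (Finset.eq_univ_iff_forall.2 hc)
  let v : Fin m → ℝ := fun i => if i ∈ S then 0 else 1
  have hI := state_mem_Icc hA (v := v) (a := 0) (b := 1)
    (fun i => by by_cases hi : i ∈ S <;> simp [v, hi]) N
  have hup := le_add_sum_flow (C := fun n => A (N + n)) (fun n => hA _) (x := state A N v)
    (fun n => rfl) (S := S) (u := 0) zero_le_one (fun p hp => by simp [state, v, hp])
    (fun n i => by simpa using (hI n i).2)
  have hlo := sub_sum_flow_le (C := fun n => A (N + n)) (fun n => hA _) (x := state A N v)
    (fun n => rfl) (S := S) (l := 1) zero_le_one (fun p hp => by simp [state, v, hp])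
    (fun n i => by simpa using (hI n i).1)
  have hge : ∀ n, (1 : ℝ) / 2 ≤ state A N v n q - state A N v n p := fun n => by
    linarith [hup n p hp, hlo n q hq, hT n]
  have := ge_of_tendsto' (h N v q p) hge
  norm_num at this

/-! ### Finite energy and infinite flow give consensus. -/

/-- Among the `m` values of `x` there is a gap of length `c / (m + 1)` between two values at
distance at least `c`. -/
lemma exists_gap {x : Fin m → ℝ} {c : ℝ} (hc : 0 < c) {i j : Fin m} (hij : c ≤ x j - x i) :
    ∃ (S : Finset (Fin m)) (a : ℝ), i ∈ S ∧ j ∉ S ∧ (∀ p ∈ S, x p ≤ a) ∧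
      ∀ q ∉ S, a + c / (m + 1) ≤ x q := by
  set g : ℝ := c / (m + 1) with hg
  have hgpos : 0 < g := by positivity
  -- Pigeonhole: `m + 1` disjoint open windows of length `g` above `x i` cannot all contain one of
  -- the `m` values.
  obtain ⟨l, hl⟩ : ∃ l : Fin (m + 1), ∀ p, x i + l * g < x p → x i + (l + 1) * g ≤ x p := by
    by_contra! hcon
    choose f hf1 hf2 using hcon
    have key : ∀ k l : Fin (m + 1), f k = f l → (k : ℕ) ≤ l := by
      intro k l hkl
      have h1 := (hf1 k).trans (hkl ▸ hf2 l)
      have h2 : (k : ℝ) < l + 1 := lt_of_mul_lt_mul_right (by linarith) hgpos.le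
      exact Nat.lt_succ_iff.1 (by exact_mod_cast h2)
    have hinj : Function.Injective f := fun k l hkl =>
      Fin.ext (le_antisymm (key k l hkl) (key l k hkl.symm))
    simpa using Fintype.card_le_of_injective f hinj
  have hlm : ((l : ℕ) : ℝ) + 1 ≤ m + 1 := by
    have := Nat.lt_succ_iff.1 l.2
    gcongr
  have hcg : (m + 1) * g = c := by rw [hg]; field_simp
  have hl0 : 0 ≤ ((l : ℕ) : ℝ) * g := by positivity
  have h1 := mul_le_mul_of_nonneg_right hlm hgpos.le
  refine ⟨Finset.univ.filter fun p => x p ≤ x i + l * g, x i + l * g, ?_, ?_, ?_, ?_⟩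
  · simpa using hl0
  · simp only [Finset.mem_filter, Finset.mem_univ, true_and, not_le]
    linarith
  · intro p hp
    simpa using hp
  · intro q hq
    have := hl q (by simpa using hq)
    linarith

/-- The price of flow: each unit crossing a gap `d` uses at least `d ^ 2` of energy, and the pairs
not crossing contribute nonnegatively. -/
lemma flow_mul_sq_le {M : Matrix (Fin m) (Fin m) ℝ} (hM : ∀ i j, 0 ≤ M i j)
    {S : Finset (Fin m)} {x : Fin m → ℝ} {d : ℝ} (hd : 0 ≤ d)
    (h : ∀ p ∈ S, ∀ q ∉ S, d ≤ x q - x p) :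
    flow S M * d ^ 2 ≤ ∑ p, ∑ q, (M p q + M q p) * (x p - x q) ^ 2 := by
  have hnn : ∀ p q, 0 ≤ (M p q + M q p) * (x p - x q) ^ 2 := fun p q =>
    mul_nonneg (add_nonneg (hM p q) (hM q p)) (sq_nonneg _)
  calc flow S M * d ^ 2 = ∑ p ∈ S, ∑ q ∈ Sᶜ, (M p q + M q p) * d ^ 2 := by
        simp only [flow, Finset.sum_mul]
    _ ≤ ∑ p ∈ S, ∑ q ∈ Sᶜ, (M p q + M q p) * (x p - x q) ^ 2 := by
        refine Finset.sum_le_sum fun p hp => Finset.sum_le_sum fun q hq => ?_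
        refine mul_le_mul_of_nonneg_left ?_ (add_nonneg (hM p q) (hM q p))
        rw [sub_sq_comm]
        exact pow_le_pow_left₀ hd (h p hp q (by simpa using hq)) 2
    _ ≤ ∑ p ∈ S, ∑ q, (M p q + M q p) * (x p - x q) ^ 2 :=
        Finset.sum_le_sum fun p _ =>
          Finset.sum_le_sum_of_subset_of_nonneg (Finset.subset_univ _) fun q _ _ => hnn p q
    _ ≤ _ := Finset.sum_le_sum_of_subset_of_nonneg (Finset.subset_univ _) fun p _ _ =>
        Finset.sum_nonneg fun q _ => hnn p q

/-- If the accumulated energy of a trajectory of a stochastic chain is small compared with a gap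
between `S` and its complement, then half of that gap persists forever. -/
lemma half_gap_le {C : ℕ → Matrix (Fin m) (Fin m) ℝ}
    (hC : ∀ n, C n ∈ Matrix.rowStochastic ℝ (Fin m)) {x : ℕ → Fin m → ℝ}
    (hx : ∀ n, x (n + 1) = C n *ᵥ x n) {K : ℝ} (hK : ∀ n p, |x n p| ≤ K)
    {S : Finset (Fin m)} {a g ε : ℝ} (hg : 0 < g) {i j : Fin m} (hi : i ∈ S) (hj : j ∉ S)
    (hup : ∀ p ∈ S, x 0 p ≤ a) (hlo : ∀ q ∉ S, a + g ≤ x 0 q)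
    (hε : ∀ n, ∑ k ∈ Finset.range n,
      ∑ p, ∑ q, (C k p q + C k q p) * (x k p - x k q) ^ 2 ≤ ε)
    (hεg : 2 * K * ε ≤ (g / 2) ^ 2 * (g / 4)) (n : ℕ) :
    ∀ p ∈ S, ∀ q ∉ S, g / 2 ≤ x n q - x n p := by
  have hK0 : 0 ≤ K := (abs_nonneg _).trans (hK 0 i)
  have haK : -K ≤ a := (abs_le.1 (hK 0 i)).1.trans (hup i hi)
  have hagK : a + g ≤ K := (hlo j hj).trans (abs_le.1 (hK 0 j)).2
  have h1 := le_add_sum_flow hC hx (R := 2 * K) (by linarith) hup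
    (fun n p => by linarith [(abs_le.1 (hK n p)).2])
  have h2 := sub_sum_flow_le hC hx (R := 2 * K) (by linarith) hlo
    (fun n p => by linarith [(abs_le.1 (hK n p)).1])
  -- Small flow before time `n` moves each side by at most `g / 4`, so the gap at `n` is at least `g
  -- / 2`. That gap in turn pays for the flow at `n`; the induction in `hflow` closes this loop.
  have hstep : ∀ n, (∑ k ∈ Finset.range n, flow S (C k)) * (g / 2) ^ 2 ≤ ε →
      ∀ p ∈ S, ∀ q ∉ S, g / 2 ≤ x n q - x n p := by
    intro n hn p hp q hq
    have h3 : 2 * K * ∑ k ∈ Finset.range n, flow S (C k) ≤ g / 4 := by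
      refine le_of_mul_le_mul_left ?_ (show 0 < (g / 2) ^ 2 by positivity)
      calc _ = 2 * K * ((∑ k ∈ Finset.range n, flow S (C k)) * (g / 2) ^ 2) := by ring
        _ ≤ 2 * K * ε := mul_le_mul_of_nonneg_left hn (by linarith)
        _ ≤ _ := hεg
    linarith [h1 n p hp, h2 n q hq]
  have hflow : ∀ n, (∑ k ∈ Finset.range n, flow S (C k)) * (g / 2) ^ 2 ≤
      ∑ k ∈ Finset.range n, ∑ p, ∑ q, (C k p q + C k q p) * (x k p - x k q) ^ 2 := by
    intro n
    induction n with
    | zero => simp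
    | succ n ih =>
      rw [Finset.sum_range_succ, Finset.sum_range_succ, add_mul]
      exact add_le_add ih
        (flow_mul_sq_le (hC n).1 (by linarith) (hstep n (ih.trans (hε n))))
  exact hstep n ((hflow n).trans (hε n))

lemma summable_energy {B : ℕ → Matrix (Fin m) (Fin m) ℝ} {x : ℕ → Fin m → ℝ}
    (h : ∀ p q, Summable fun n => B n p q * (x n p - x n q) ^ 2) :
    Summable fun n => ∑ p, ∑ q, (B n p q + B n q p) * (x n p - x n q) ^ 2 := by
  refine summable_sum fun p _ => summable_sum fun q _ => ?_
  refine ((h p q).add (h q p)).congr fun n => ?_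
  rw [add_mul, sub_sq_comm (x n q)]

/-- If the energies of a trajectory with respect to the driving chain `A` and to a nonnegative
chain `B` with infinite flow are both finite, then the trajectory reaches consensus. -/
theorem tendsto_state_sub_of_summable {A B : ℕ → Matrix (Fin m) (Fin m) ℝ}
    (hA : ∀ n, A n ∈ Matrix.rowStochastic ℝ (Fin m)) (hB : ∀ n i j, 0 ≤ B n i j)
    (hflow : HasInfiniteFlow B) {t₀ : ℕ} {v : Fin m → ℝ}
    (hAs : ∀ p q, Summable fun n =>
      A (t₀ + n) p q * (state A t₀ v n p - state A t₀ v n q) ^ 2)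
    (hBs : ∀ p q, Summable fun n =>
      B (t₀ + n) p q * (state A t₀ v n p - state A t₀ v n q) ^ 2) (i j : Fin m) :
    Tendsto (fun n => state A t₀ v n i - state A t₀ v n j) atTop (𝓝 0) := by
  set x := state A t₀ v with hxdef
  have hK : ∀ n p, |x n p| ≤ ∑ j, |v j| := abs_state_le hA t₀ v
  set K := ∑ j, |v j|
  have hK0 : 0 ≤ K := Finset.sum_nonneg fun j _ => abs_nonneg _
  set eA : ℕ → ℝ := fun n => ∑ p, ∑ q, (A (t₀ + n) p q + A (t₀ + n) q p) * (x n p - x n q) ^ 2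
    with heA
  have hsA : Summable eA := summable_energy (B := fun n => A (t₀ + n)) hAs
  have hsB := summable_energy (B := fun n => B (t₀ + n)) hBs
  have heA0 : ∀ n, 0 ≤ eA n := fun n => Finset.sum_nonneg fun p _ => Finset.sum_nonneg fun q _ =>
    mul_nonneg (add_nonneg ((hA _).1 p q) ((hA _).1 q p)) (sq_nonneg _)
  by_contra hcon
  obtain ⟨c, hc, hfreq⟩ : ∃ c > 0, ∃ᶠ n in atTop, c ≤ |x n i - x n j| := by
    rw [Metric.tendsto_nhds] at hcon
    push Not at hcon
    simpa [Real.dist_eq] using hcon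
  set g : ℝ := c / (m + 1) with hg
  have hgpos : 0 < g := by positivity
  have hsmall : ∀ᶠ N in atTop, 2 * K * ∑' k, eA (k + N) ≤ (g / 2) ^ 2 * (g / 4) := by
    have h := (tendsto_sum_nat_add eA).const_mul (2 * K)
    rw [mul_zero] at h
    exact h.eventually_le_const (by positivity)
  obtain ⟨N, hN, hNs⟩ := (hfreq.and_eventually hsmall).exists
  obtain ⟨i', j', hij⟩ : ∃ i' j', c ≤ x N j' - x N i' := by
    rcases le_abs.1 hN with h | h
    · exact ⟨j, i, h⟩
    · exact ⟨i, j, by linarith⟩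
  obtain ⟨S, a, hiS, hjS, hup, hlo⟩ := exists_gap hc hij
  have hgap := half_gap_le (C := fun n => A (t₀ + (N + n))) (fun n => hA _)
    (x := fun n => x (N + n)) (fun n => rfl) (fun n p => hK _ p) hgpos hiS hjS hup hlo
    (fun n => by
      have := ((summable_nat_add_iff N).2 hsA).sum_le_tsum (Finset.range n) fun k _ => heA0 _
      simpa only [heA, add_comm _ N] using this) (by simpa only [add_comm _ N] using hNs)
  -- The gap was preserved by the energy of `A`; it is now charged to the energy of `B`.
  have hle : ∀ n, flow S (B (t₀ + (N + n))) * (g / 2) ^ 2 ≤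
      ∑ p, ∑ q, (B (t₀ + (N + n)) p q + B (t₀ + (N + n)) q p) *
        (x (N + n) p - x (N + n) q) ^ 2 :=
    fun n => flow_mul_sq_le (hB _) (by positivity) (hgap n)
  have hsB' := (summable_nat_add_iff N).2 hsB
  simp only [add_comm _ N] at hsB'
  have hs : Summable fun n => flow S (B (t₀ + (N + n))) := by
    rw [← summable_mul_right_iff (show (g / 2) ^ 2 ≠ 0 by positivity)]
    exact Summable.of_nonneg_of_le
      (fun n => mul_nonneg (flow_nonneg (hB _) S) (sq_nonneg _)) hle hsB'
  have hs' : Summable fun n => flow S (B n) := by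
    rw [← summable_nat_add_iff (t₀ + N)]
    exact hs.congr fun n => by rw [← add_assoc, add_comm n]
  refine (not_summable_iff_tendsto_nat_atTop_of_nonneg fun k => flow_nonneg (hB k) S).2
    (hflow S ⟨i', hiS⟩ ?_) hs'
  rintro rfl
  exact hjS (Finset.mem_univ _)

/-! ### Linearity, measurability and independence of the state. -/

lemma state_sum_smul (A : ℕ → Matrix (Fin m) (Fin m) ℝ) (t₀ : ℕ) (v : Fin m → ℝ) (n : ℕ) :
    state A t₀ v n = ∑ l, v l • state A t₀ (Pi.single l 1) n := by
  induction n with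
  | zero =>
    ext i
    simp [state, Pi.single_apply]
  | succ n ih =>
    simp only [state]
    rw [ih, Matrix.mulVec_sum]
    simp only [Matrix.mulVec_smul]

/-- Ergodicity can be tested on the standard basis. -/
lemma isErgodic_of_single {A : ℕ → Matrix (Fin m) (Fin m) ℝ}
    (h : ∀ (t₀ : ℕ) (l i j : Fin m), Tendsto (fun n =>
      state A t₀ (Pi.single l 1) n i - state A t₀ (Pi.single l 1) n j) atTop (𝓝 0)) :
    IsErgodic A := by
  intro t₀ v i j
  have := tendsto_finsetSum Finset.univ fun l _ => (h t₀ l i j).const_mul (v l)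
  simp only [mul_zero, Finset.sum_const_zero] at this
  refine this.congr fun n => ?_
  rw [state_sum_smul A t₀ v n]
  simp [Finset.sum_apply, mul_sub]

lemma state_congr {A B : ℕ → Matrix (Fin m) (Fin m) ℝ} {t₀ n : ℕ}
    (h : ∀ k < t₀ + n, A k = B k) (v : Fin m → ℝ) : state A t₀ v n = state B t₀ v n := by
  induction n with
  | zero => rfl
  | succ n ih =>
    simp only [state]
    rw [ih fun k hk => h k (by omega), h _ (by omega)]

lemma measurable_state {Ω : Type*} [MeasurableSpace Ω] {W : ℕ → Ω → Matrix (Fin m) (Fin m) ℝ}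
    (hW : ∀ k i j, Measurable fun ω => W k ω i j) (t₀ : ℕ) (v : Fin m → ℝ) (n : ℕ) (i : Fin m) :
    Measurable fun ω => state (fun k => W k ω) t₀ v n i := by
  induction n generalizing i with
  | zero => exact measurable_const
  | succ n ih =>
    simp only [state, Matrix.mulVec, dotProduct]
    exact Finset.measurable_sum _ fun j _ => (hW _ i j).mul (ih j)

variable {Ω : Type*} [MeasurableSpace Ω] {μ : Measure Ω} {W : ℕ → Ω → Matrix (Fin m) (Fin m) ℝ}

/-- For an independent model, the state at time `t₀ + n` is independent of `W (t₀ + n)`. -/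
lemma indepFun_entry_state (hW : IsRandomModel W) (hind : IsIndependentModel μ W) (t₀ : ℕ)
    (v : Fin m → ℝ) (n : ℕ) (i j : Fin m) :
    IndepFun (fun ω => W (t₀ + n) ω i j) (fun ω => state (fun k => W k ω) t₀ v n) μ := by
  have hmeas : ∀ k, Measurable fun ω => (fun i j => W k ω i j : Fin m → Fin m → ℝ) := fun k =>
    measurable_pi_lambda _ fun i => measurable_pi_lambda _ fun j => hW.measurable_entry k i j
  have h := iIndepFun.indepFun_finset {t₀ + n} (Finset.range (t₀ + n)) (by simp) hind hmeas
  let φ : (({t₀ + n} : Finset ℕ) → Fin m → Fin m → ℝ) → ℝ :=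
    fun w => w ⟨t₀ + n, Finset.mem_singleton_self _⟩ i j
  -- The state as a function of the past matrices only; the default `0` is never read before time
  -- `t₀ + n`.
  let M : ℕ → (Finset.range (t₀ + n) → Fin m → Fin m → ℝ) → Matrix (Fin m) (Fin m) ℝ :=
    fun k w => if hk : k ∈ Finset.range (t₀ + n) then Matrix.of (w ⟨k, hk⟩) else 0
  have hM : ∀ k i j, Measurable fun w => M k w i j := by
    intro k i j
    by_cases hk : k ∈ Finset.range (t₀ + n)
    · simp only [M, hk, dite_true, Matrix.of_apply]
      fun_prop
    · simp only [M, hk, dite_false, Matrix.zero_apply]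
      exact measurable_const
  have hφ : Measurable φ := by fun_prop
  have hψ : Measurable fun w => state (fun k => M k w) t₀ v n :=
    measurable_pi_lambda _ fun i => measurable_state hM t₀ v n i
  have h' := h.comp hφ hψ
  have hψ' : (fun ω => state (fun k => W k ω) t₀ v n) =
      (fun w => state (fun k => M k w) t₀ v n) ∘
        fun ω (k : Finset.range (t₀ + n)) i j => W k ω i j := by
    ext1 ω
    refine state_congr (fun k hk => ?_) v
    simp only [M, Finset.mem_range, hk, dite_true]
    rfl
  rw [hψ']
  exact h'

/-- A series of nonnegative functions with summable integrals converges almost everywhere. -/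
lemma ae_summable_of_summable_integral {f : ℕ → Ω → ℝ} (hf : ∀ n, Integrable (f n) μ)
    (h0 : ∀ n ω, 0 ≤ f n ω) (hs : Summable fun n => ∫ ω, f n ω ∂μ) :
    ∀ᵐ ω ∂μ, Summable fun n => f n ω := by
  have hfin : ∫⁻ ω, ∑' n, ENNReal.ofReal (f n ω) ∂μ ≠ ⊤ := by
    rw [lintegral_tsum fun n => (hf n).aemeasurable.ennreal_ofReal]
    simp only [← ofReal_integral_eq_lintegral_ofReal (hf _) (ae_of_all _ (h0 _))]
    exact hs.tsum_ofReal_ne_top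
  filter_upwards [ae_lt_top' (AEMeasurable.tsum fun n =>
    (hf n).aemeasurable.ennreal_ofReal) hfin] with ω hω
  refine (ENNReal.summable_toReal hω.ne).congr fun n => ?_
  exact ENNReal.toReal_ofReal (h0 n ω)

/-! ### The expected model. -/

variable [IsProbabilityMeasure μ]

lemma integrable_entry (hW : IsRandomModel W) (k : ℕ) (i j : Fin m) :
    Integrable (fun ω => W k ω i j) μ :=
  Integrable.of_bound (hW.measurable_entry k i j).aestronglyMeasurable 1 <| ae_of_all _ fun ω => by
    rw [Real.norm_of_nonneg ((hW.stochastic k ω).1 i j)]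
    exact Matrix.le_one_of_mem_rowStochastic (hW.stochastic k ω)

lemma expectedModel_mem_rowStochastic (hW : IsRandomModel W) (k : ℕ) :
    expectedModel μ W k ∈ Matrix.rowStochastic ℝ (Fin m) := by
  rw [Matrix.mem_rowStochastic_iff_sum]
  refine ⟨fun i j => integral_nonneg fun ω => (hW.stochastic k ω).1 i j, fun i => ?_⟩
  simp only [expectedModel, expectation, Matrix.of_apply]
  rw [← integral_finsetSum _ fun j _ => integrable_entry hW k i j]
  simp [Matrix.sum_row_of_mem_rowStochastic (hW.stochastic k _) i]

lemma integrable_state (hW : IsRandomModel W) (t₀ : ℕ) (v : Fin m → ℝ) (n : ℕ) (i : Fin m) :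
    Integrable (fun ω => state (fun k => W k ω) t₀ v n i) μ :=
  Integrable.of_bound (measurable_state hW.measurable_entry t₀ v n i).aestronglyMeasurable
    (∑ j, |v j|) <| ae_of_all _ fun ω => abs_state_le (fun k => hW.stochastic k ω) t₀ v n i

/-- For an independent model, the expected state follows the expected model. -/
lemma state_expectedModel (hW : IsRandomModel W) (hind : IsIndependentModel μ W) (t₀ : ℕ)
    (v : Fin m → ℝ) (n : ℕ) (i : Fin m) :
    state (expectedModel μ W) t₀ v n i = ∫ ω, state (fun k => W k ω) t₀ v n i ∂μ := by
  induction n generalizing i with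
  | zero => simp [state]
  | succ n ih =>
    have hmul : ∀ j, IndepFun (fun ω => W (t₀ + n) ω i j)
        (fun ω => state (fun k => W k ω) t₀ v n j) μ := fun j =>
      (indepFun_entry_state hW hind t₀ v n i j).comp measurable_id (measurable_pi_apply j)
    simp only [state, Matrix.mulVec, dotProduct]
    have hint : ∀ j, Integrable
        (fun ω => W (t₀ + n) ω i j * state (fun k => W k ω) t₀ v n j) μ := fun j =>
      (hmul j).integrable_mul (integrable_entry hW _ i j) (integrable_state hW t₀ v n j)
    rw [integral_finsetSum _ fun j _ => hint j]
    refine Finset.sum_congr rfl fun j _ => ?_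
    rw [ih, (hmul j).integral_fun_mul_eq_mul_integral
      (hW.measurable_entry _ i j).aestronglyMeasurable
      (measurable_state hW.measurable_entry t₀ v n j).aestronglyMeasurable]
    rfl

/-- The expected model of an ergodic independent model is ergodic. -/
theorem IsErgodicModel.isErgodic_expectedModel (hW : IsRandomModel W)
    (hind : IsIndependentModel μ W) (h : IsErgodicModel μ W) : IsErgodic (expectedModel μ W) := by
  intro t₀ v i j
  simp only [state_expectedModel hW hind]
  simp only [← integral_sub (integrable_state hW t₀ v _ i) (integrable_state hW t₀ v _ j)]
  have := tendsto_integral_filter_of_norm_le_const (μ := μ) (l := atTop) (f := fun _ => (0 : ℝ))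
    (F := fun n ω => state (fun k => W k ω) t₀ v n i - state (fun k => W k ω) t₀ v n j)
    (Eventually.of_forall fun n =>
      ((integrable_state hW t₀ v n i).sub (integrable_state hW t₀ v n j)).aestronglyMeasurable)
    ⟨(∑ j, |v j|) + ∑ j, |v j|, Eventually.of_forall fun n => ae_of_all _ fun ω =>
      (norm_sub_le _ _).trans (add_le_add (abs_state_le (fun k => hW.stochastic k ω) t₀ v n i)
        (abs_state_le (fun k => hW.stochastic k ω) t₀ v n j))⟩
    (h.mono fun ω hω => hω t₀ v i j)
  simpa using this

/-- The expected model of a model with infinite flow has infinite flow. -/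
theorem HasInfiniteFlowModel.expectedModel (hW : IsRandomModel W)
    (h : HasInfiniteFlowModel μ W) : HasInfiniteFlow (expectedModel μ W) := by
  intro S hS hS'
  have hE : ∀ k, flow S (InfiniteFlow.expectedModel μ W k) = ∫ ω, flow S (W k ω) ∂μ := by
    intro k
    simp only [flow, InfiniteFlow.expectedModel, expectation, Matrix.of_apply]
    have hint : ∀ i j, Integrable (fun ω => W k ω i j + W k ω j i) μ := fun i j =>
      (integrable_entry hW k i j).add (integrable_entry hW k j i)
    rw [integral_finsetSum _ fun i _ => integrable_finsetSum _ fun j _ => hint i j]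
    refine Finset.sum_congr rfl fun i _ => ?_
    rw [integral_finsetSum _ fun j _ => hint i j]
    exact Finset.sum_congr rfl fun j _ =>
      (integral_add (integrable_entry hW k i j) (integrable_entry hW k j i)).symm
  rw [← not_summable_iff_tendsto_nat_atTop_of_nonneg fun k =>
    flow_nonneg (expectedModel_mem_rowStochastic hW k).1 S]
  intro hsum
  simp only [hE] at hsum
  have hae := ae_summable_of_summable_integral (f := fun k ω => flow S (W k ω))
    (fun k => integrable_finsetSum _ fun i _ => integrable_finsetSum _ fun j _ =>
      (integrable_entry hW k i j).add (integrable_entry hW k j i))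
    (fun k ω => flow_nonneg (hW.stochastic k ω).1 S) hsum
  obtain ⟨ω, hω, hω'⟩ := (hae.and h).exists
  exact (not_summable_iff_tendsto_nat_atTop_of_nonneg fun k =>
    flow_nonneg (hW.stochastic k ω).1 S).2 (hω' S hS hS') hω

/-! ### From finite expected energy to ergodicity. -/

/-- In the class `M₂` with weak feedback, the energy of every trajectory with respect to the
expected model is finite. -/
lemma summable_expectedModel_mul (hW : IsRandomModel W) (hM2 : IsClassM2 μ W)
    (hfb : HasWeakFeedback μ W) (t₀ : ℕ) (v : Fin m → ℝ) (p q : Fin m) :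
    Summable fun n => expectedModel μ W (t₀ + n) p q *
      ∫ ω, (state (fun k => W k ω) t₀ v n p - state (fun k => W k ω) t₀ v n q) ^ 2 ∂μ := by
  obtain ⟨γ, hγ, hfb⟩ := hfb
  have hE0 : ∀ k i j, 0 ≤ expectedModel μ W k i j := fun k =>
    (expectedModel_mem_rowStochastic hW k).1
  set V : ℕ → Fin m → Fin m → ℝ := fun n i j =>
    ∫ ω, (state (fun k => W k ω) t₀ v n i - state (fun k => W k ω) t₀ v n j) ^ 2 ∂μ with hV
  have hV0 : ∀ n i j, 0 ≤ V n i j := fun n i j => integral_nonneg fun ω => sq_nonneg _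
  have hVc : ∀ n i j, V n i j = V n j i := fun n i j => by simp only [hV, sub_sq_comm]
  set H : ℕ → Fin m → Fin m → ℝ := fun k i j =>
    expectation μ (fun ω => (W k ω)ᵀ * W k ω) i j with hH
  have hH0 : ∀ k i j, 0 ≤ H k i j := fun k i j => integral_nonneg fun ω => by
    change 0 ≤ ((W k ω)ᵀ * W k ω) i j
    rw [Matrix.mul_apply]
    exact Finset.sum_nonneg fun l _ =>
      mul_nonneg ((hW.stochastic k ω).1 l i) ((hW.stochastic k ω).1 l j)
  have hfb' : ∀ k i j, i ≠ j → γ * (expectedModel μ W k i j + expectedModel μ W k j i) ≤ H k i j :=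
    fun k i j hij => hfb k i j hij
  have hs : Summable fun n => ∑ i, ∑ j ∈ Finset.Ioi i, H (t₀ + n) i j * V n i j := hM2.2 t₀ v
  have hpair : ∀ i j, i < j → Summable fun n =>
      (expectedModel μ W (t₀ + n) i j + expectedModel μ W (t₀ + n) j i) * V n i j := by
    intro i j hij
    refine Summable.of_nonneg_of_le (fun n => mul_nonneg (add_nonneg (hE0 _ _ _) (hE0 _ _ _))
      (hV0 n i j)) (fun n => ?_) (hs.mul_left γ⁻¹)
    have hterm : ∀ i j, 0 ≤ H (t₀ + n) i j * V n i j := fun i j =>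
      mul_nonneg (hH0 _ i j) (hV0 n i j)
    have h1 : H (t₀ + n) i j * V n i j ≤
        ∑ i, ∑ j ∈ Finset.Ioi i, H (t₀ + n) i j * V n i j :=
      (Finset.single_le_sum (f := fun j => H (t₀ + n) i j * V n i j) (fun j _ => hterm i j)
        (Finset.mem_Ioi.2 hij)).trans
      (Finset.single_le_sum (f := fun i => ∑ j ∈ Finset.Ioi i, H (t₀ + n) i j * V n i j)
        (fun i _ => Finset.sum_nonneg fun j _ => hterm i j) (Finset.mem_univ i))
    rw [le_inv_mul_iff₀ hγ, ← mul_assoc]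
    exact (mul_le_mul_of_nonneg_right (hfb' _ i j hij.ne) (hV0 n i j)).trans h1
  rcases lt_trichotomy p q with hpq | rfl | hpq
  · exact Summable.of_nonneg_of_le (fun n => mul_nonneg (hE0 _ _ _) (hV0 n p q))
      (fun n => mul_le_mul_of_nonneg_right (le_add_of_nonneg_right (hE0 _ _ _)) (hV0 n p q))
      (hpair p q hpq)
  -- Weak feedback says nothing on the diagonal, but there the difference vanishes.
  · simp
  · refine Summable.of_nonneg_of_le (fun n => mul_nonneg (hE0 _ _ _) (hV0 n p q))
      (fun n => ?_) (hpair q p hpq)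
    change _ * V n p q ≤ _
    rw [hVc n p q]
    exact mul_le_mul_of_nonneg_right (le_add_of_nonneg_left (hE0 _ _ _)) (hV0 n q p)

/-- In the class `M₂` with weak feedback, infinite flow of the expected model forces ergodicity. -/
theorem isErgodicModel_of_hasInfiniteFlow_expectedModel (hW : IsRandomModel W)
    (hM2 : IsClassM2 μ W) (hfb : HasWeakFeedback μ W)
    (h : HasInfiniteFlow (expectedModel μ W)) : IsErgodicModel μ W := by
  have hsq : ∀ t₀ v n p q, Integrable (fun ω =>
      (state (fun k => W k ω) t₀ v n p - state (fun k => W k ω) t₀ v n q) ^ 2) μ := by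
    intro t₀ v n p q
    refine Integrable.of_bound (((measurable_state hW.measurable_entry t₀ v n p).sub
      (measurable_state hW.measurable_entry t₀ v n q)).pow_const 2).aestronglyMeasurable
      (((∑ j, |v j|) + ∑ j, |v j|) ^ 2) (ae_of_all _ fun ω => ?_)
    rw [norm_pow]
    exact pow_le_pow_left₀ (norm_nonneg _) ((norm_sub_le _ _).trans
      (add_le_add (abs_state_le (fun k => hW.stochastic k ω) t₀ v n p)
        (abs_state_le (fun k => hW.stochastic k ω) t₀ v n q))) 2
  have hB : ∀ t₀ v p q, ∀ᵐ ω ∂μ, Summable fun n => expectedModel μ W (t₀ + n) p q *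
      (state (fun k => W k ω) t₀ v n p - state (fun k => W k ω) t₀ v n q) ^ 2 := by
    intro t₀ v p q
    refine ae_summable_of_summable_integral (fun n => (hsq t₀ v n p q).const_mul _)
      (fun n ω => mul_nonneg ((expectedModel_mem_rowStochastic hW _).1 p q) (sq_nonneg _)) ?_
    simp only [integral_const_mul]
    exact summable_expectedModel_mul hW hM2 hfb t₀ v p q
  have hA : ∀ t₀ v p q, ∀ᵐ ω ∂μ, Summable fun n => W (t₀ + n) ω p q *
      (state (fun k => W k ω) t₀ v n p - state (fun k => W k ω) t₀ v n q) ^ 2 := by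
    intro t₀ v p q
    have hind : ∀ n, IndepFun (fun ω => W (t₀ + n) ω p q) (fun ω =>
        (state (fun k => W k ω) t₀ v n p - state (fun k => W k ω) t₀ v n q) ^ 2) μ := fun n =>
      (indepFun_entry_state hW hM2.1 t₀ v n p q).comp (φ := id)
        (ψ := fun x : Fin m → ℝ => (x p - x q) ^ 2) measurable_id (by fun_prop)
    refine ae_summable_of_summable_integral
      (fun n => (hind n).integrable_mul (integrable_entry hW _ p q) (hsq t₀ v n p q))
      (fun n ω => mul_nonneg ((hW.stochastic _ ω).1 p q) (sq_nonneg _)) ?_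
    -- Independence turns the weight `E[W_pq]` outside the integral into the random `W_pq` inside
    -- it.
    refine (summable_expectedModel_mul hW hM2 hfb t₀ v p q).congr fun n => ?_
    exact ((hind n).integral_fun_mul_eq_mul_integral
      (hW.measurable_entry _ p q).aestronglyMeasurable
      (hsq t₀ v n p q).aestronglyMeasurable).symm
  -- Restricting to basis vectors leaves countably many null sets; linearity recovers every starting
  -- point.
  have hall : ∀ᵐ ω ∂μ, ∀ (t₀ : ℕ) (l p q : Fin m),
      (Summable fun n => W (t₀ + n) ω p q * (state (fun k => W k ω) t₀ (Pi.single l 1) n p -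
        state (fun k => W k ω) t₀ (Pi.single l 1) n q) ^ 2) ∧
      Summable fun n => expectedModel μ W (t₀ + n) p q *
        (state (fun k => W k ω) t₀ (Pi.single l 1) n p -
          state (fun k => W k ω) t₀ (Pi.single l 1) n q) ^ 2 := by
    simp only [ae_all_iff]
    exact fun t₀ l p q => (hA t₀ _ p q).and (hB t₀ _ p q)
  filter_upwards [hall] with ω hω
  exact isErgodic_of_single fun t₀ l i j =>
    tendsto_state_sub_of_summable (fun k => hW.stochastic k ω)
      (fun k => (expectedModel_mem_rowStochastic hW k).1) h
      (fun p q => (hω t₀ l p q).1) (fun p q => (hω t₀ l p q).2) i j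

end InfiniteFlow

theorem mainTheorem4 {Ω : Type*} [MeasurableSpace Ω] (μ : Measure Ω) [IsProbabilityMeasure μ]
    {m : ℕ} (W : ℕ → Ω → Matrix (Fin m) (Fin m) ℝ)
    (hW : InfiniteFlow.IsRandomModel W)
    (hM2 : InfiniteFlow.IsClassM2 μ W)
    (hfb : InfiniteFlow.HasWeakFeedback μ W) :
    List.TFAE
      [InfiniteFlow.IsErgodicModel μ W,
       InfiniteFlow.HasInfiniteFlowModel μ W,
       InfiniteFlow.HasInfiniteFlow (InfiniteFlow.expectedModel μ W),
       InfiniteFlow.IsErgodic (InfiniteFlow.expectedModel μ W)] := by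
  tfae_have 1 → 2 := fun h => h.mono fun ω hω => hω.hasInfiniteFlow fun k => hW.stochastic k ω
  tfae_have 2 → 3 := fun h => h.expectedModel hW
  tfae_have 3 → 1 := InfiniteFlow.isErgodicModel_of_hasInfiniteFlow_expectedModel hW hM2 hfb
  tfae_have 1 → 4 := fun h => h.isErgodic_expectedModel hW hM2.1
  tfae_have 4 → 3 := fun h =>
    h.hasInfiniteFlow (InfiniteFlow.expectedModel_mem_rowStochastic hW)
  tfae_finish
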